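/- **Setting.** Let $M$ be a smooth (finite-dimensional) manifold with a smooth nondegenerate symmetric tensor field $g$ of type $(0,2)$ (of arbitrary signature), Levi-Civita connection $\nabla$, curvature tensor $R(X,Y)Z=\nabla_X\nabla_YZ-\nabla_Y\nabla_XZ-\nabla_{[X,Y]}Z$ and Ricci tensor $\mathrm{Ric}(X,Y)=\mathrm{tr}(Z\mapsto R(Z,X)Y)$. For a geodesic $\gamma\colon I\to M$ on an open interval $I$ let $\mathcal R_\gamma(t)=R(\,\cdot\,,\dot\gamma(t))\dot\gamma(t)$ be the Jacobi operator. $(M,g)$ is called a *$\mathfrak C_0$-space* if along every geodesic $\gamma$ there is a parallel $g$-skew-symmetric endomorphism field $C_\gamma$ with $\frac{\nabla}{dt}\mathcal R_\gamma=[C_\gamma,\mathcal R_\gamma]$ on $I$. For $p\in M$, $k\ge 0$ and $X\in T_pM$ define $\mathcal R^k(X)\in\mathrm{End}(T_pM)$ by $\mathcal R^k(X)Y=(\nabla^k_{X,\dots,X}R)(Y,X)X$. Let $\mathscr P(T_pM)$ be the algebra of real polynomial functions on $T_pM$ and $\mathscr P^i(T_pM)$ its subspace of homogeneous functions of degree $i$.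 A *minimal polynomial* of $(M,g)$ at $p$ is a polynomial $P=\sum_{i=0}^k a_i\lambda^{k-i}\in\mathscr P(T_pM)[\lambda]$ with $a_0=1$ and $a_i\in\mathscr P^i(T_pM)$ for all $i$, such that $\sum_{i=0}^k a_i(X)\,\mathcal R^{k-i}(X)=0$ for all $X\in T_pM$ and such that the set $$U(p)=\{X\in T_pM \mid \mathcal R^0(X),\dots,\mathcal R^{k-1}(X)\text{ are linearly independent in }\mathrm{End}(T_pM)\}$$ is nonempty. (It is unique if it exists, and is denoted $P_{\min}(M,g,p)$.) Its *specialization* at $X\in T_pM$ is $P_{\min}(M,g,p)(X)=\sum_{i=0}^k a_i(X)\lambda^{k-i}\in\mathbb R[\lambda]$. **Theorem.** Let $(M,g)$ be a $\mathfrak C_0$-space, $p\in M$, and let $P_{\min}(M,g,p)=\sum_{i=0}^k a_i\lambda^{k-i}$ be the minimal polynomial at $p$. (a) If $g$ is positive definite, then for every $X\in U(p)$ all complex roots of the specialization $P_{\min}(M,g,p)(X)\in\mathbb R[\lambda]$ are purely imaginary (i.e. have real part $0$; the root $0$ is allowed) and simple. (b) If $\mathrm{Ric}|_p\neq 0$,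 then $a_k=0$. -/

import Mathlib

open scoped Manifold ContDiff Topology

noncomputable section

/-! ## Pseudo-Riemannian metrics -/

section Metric

variable (E : Type*) [NormedAddCommGroup E] [NormedSpace ℝ E]
  (M : Type*) [TopologicalSpace M] [ChartedSpace E M] [IsManifold 𝓘(ℝ, E) ∞ M]

/-- A smooth nondegenerate symmetric tensor field `g` of type `(0,2)`, of arbitrary signature. -/
structure PseudoRiemannianMetric where
  inner (q : M) :
    TangentSpace 𝓘(ℝ, E) q →L[ℝ] TangentSpace 𝓘(ℝ, E) q →L[ℝ] ℝ
  symm (q : M) (v w : TangentSpace 𝓘(ℝ, E) q) : inner q v w = inner q w v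
  nondegenerate (q : M) (v : TangentSpace 𝓘(ℝ, E) q) (hv : ∀ w, inner q v w = 0) : v = 0
  contMDiff : ContMDiff 𝓘(ℝ, E) (𝓘(ℝ, E).prod 𝓘(ℝ, E →L[ℝ] E →L[ℝ] ℝ)) ∞
    (fun q ↦ Bundle.TotalSpace.mk' (E →L[ℝ] E →L[ℝ] ℝ)
      (E := fun q : M ↦ TangentSpace 𝓘(ℝ, E) q →L[ℝ] TangentSpace 𝓘(ℝ, E) q →L[ℝ] ℝ)
      q (inner q))

end Metric

/-! ## Tensor calculus in an open piece of a vector space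

Here `h : E → E →L[ℝ] E →L[ℝ] ℝ` is a metric in coordinates, `h x u v = h_x(u, v)`. -/

namespace Coord

variable {E : Type*} [NormedAddCommGroup E] [NormedSpace ℝ E]

set_option maxSynthPendingDepth 3 in
/-- The Christoffel symbols of the first kind,
`Γ₁(u, v, w) = ½ ((D_u h)(v, w) + (D_v h)(u, w) - (D_w h)(u, v))`. -/
def christoffelFirst (h : E → E →L[ℝ] E →L[ℝ] ℝ) (x : E) : E →L[ℝ] E →L[ℝ] E →L[ℝ] ℝ :=
  let D : E →L[ℝ] E →L[ℝ] E →L[ℝ] ℝ := fderiv ℝ h x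
  let F : (E →L[ℝ] E →L[ℝ] ℝ) →L[ℝ] (E →L[ℝ] E →L[ℝ] ℝ) :=
    (ContinuousLinearMap.flipₗᵢ ℝ E E ℝ).toContinuousLinearEquiv.toContinuousLinearMap
  (1 / 2 : ℝ) • (D + D.flip - F.comp D.flip)

set_option maxSynthPendingDepth 3 in
theorem christoffelFirst_apply (h : E → E →L[ℝ] E →L[ℝ] ℝ) (x u v w : E) :
    christoffelFirst h x u v w =
      (1 / 2) * (fderiv ℝ h x u v w + fderiv ℝ h x v u w - fderiv ℝ h x w u v) := by
  simp [christoffelFirst]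

/-- The Christoffel symbols `Γ_x(u, v)` of the Levi-Civita connection of `h`, so that
`∇_u V = D_u V + Γ(u, V)`: the vector with `h_x(Γ_x(u, v), w) = Γ₁(u, v, w)` for all `w`. -/
def christoffel (h : E → E →L[ℝ] E →L[ℝ] ℝ) (x : E) : E →L[ℝ] E →L[ℝ] E :=
  ContinuousLinearMap.compL ℝ E (E →L[ℝ] ℝ) E (h x).inverse ∘L christoffelFirst h x

theorem christoffel_apply (h : E → E →L[ℝ] E →L[ℝ] ℝ) (x u v : E) :
    christoffel h x u v = (h x).inverse (christoffelFirst h x u v) := rfl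

/-- The first half of the curvature, `(u, v, w) ↦ (D_u Γ)(v, w) + Γ(u, Γ(v, w))`. -/
def halfCurv (h : E → E →L[ℝ] E →L[ℝ] ℝ) (x : E) : E →L[ℝ] E →L[ℝ] E →L[ℝ] E :=
  fderiv ℝ (christoffel h) x +
    (ContinuousLinearMap.compL ℝ E E E).bilinearComp (christoffel h x) (christoffel h x)

/-- The curvature `R(u, v)w = ∇_u ∇_v w - ∇_v ∇_u w - ∇_{[u, v]} w` in coordinates. -/
def curv (h : E → E →L[ℝ] E →L[ℝ] ℝ) (x : E) : E →L[ℝ] E →L[ℝ] E →L[ℝ] E :=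
  halfCurv h x - (halfCurv h x).flip

theorem curv_apply (h : E → E →L[ℝ] E →L[ℝ] ℝ) (x u v w : E) :
    curv h x u v w =
      fderiv ℝ (christoffel h) x u v w - fderiv ℝ (christoffel h) x v u w
      + christoffel h x u (christoffel h x v w) - christoffel h x v (christoffel h x u w) := by
  simp [curv, halfCurv]
  abel

/-- A curried trilinear map as a multilinear map on `Fin 3`. -/
def uncurry₃ (A : E →L[ℝ] E →L[ℝ] E →L[ℝ] E) : E [×3]→L[ℝ] E :=
  ((continuousMultilinearCurryLeftEquiv ℝ (fun _ : Fin 3 ↦ E) E).symm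
    (((continuousMultilinearCurryLeftEquiv ℝ (fun _ : Fin 2 ↦ E) E).symm
        |>.toContinuousLinearEquiv.toContinuousLinearMap) ∘L
      (ContinuousLinearMap.compL ℝ E (E →L[ℝ] E) (E [×1]→L[ℝ] E)
        ((continuousMultilinearCurryFin1 ℝ E E).symm
          |>.toContinuousLinearEquiv.toContinuousLinearMap)) ∘L A))

theorem uncurry₃_apply (A : E →L[ℝ] E →L[ℝ] E →L[ℝ] E) (v : Fin 3 → E) :
    uncurry₃ A v = A (v 0) (v 1) (v 2) := by
  simp [uncurry₃]
  rfl

/-- The derivation action of an endomorphism `A` on a tensor `T` of type `(1, r)`: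
`(A · T)(v₁, …, v_r) = A (T(v₁, …, v_r)) - ∑ i, T(v₁, …, A v_i, …, v_r)`. -/
def act {r : ℕ} (T : E [×r]→L[ℝ] E) : (E →L[ℝ] E) →L[ℝ] (E [×r]→L[ℝ] E) :=
  (ContinuousLinearMap.compContinuousMultilinearMapL ℝ (fun _ : Fin r ↦ E) E E).flip T
  - ∑ i : Fin r,
      ((ContinuousMultilinearMap.compContinuousLinearMapContinuousMultilinear ℝ
        (fun _ : Fin r ↦ E) (fun _ : Fin r ↦ E) E).toContinuousLinearMap
          (fun _ ↦ ContinuousLinearMap.id ℝ E) i).flip T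

theorem act_apply {r : ℕ} (T : E [×r]→L[ℝ] E) (A : E →L[ℝ] E) (v : Fin r → E) :
    act T A v = A (T v) - ∑ i, T (Function.update v i (A (v i))) := by
  simp only [act, sub_apply, sum_apply, ContinuousLinearMap.flip_apply]
  congr 1
  refine Finset.sum_congr rfl fun i _ ↦ ?_
  change T (fun j ↦ (Function.update (fun _ : Fin r ↦ ContinuousLinearMap.id ℝ E) i A j) (v j)) = _
  congr 1
  funext j
  rcases eq_or_ne j i with rfl | hj
  · simp
  · simp [hj]

/-- The covariant derivative of a tensor field `T` of type `(1, r)` in coordinates: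
`(∇T)(u, v₁, …, v_r) = (D_u T)(v₁, …, v_r) + (Γ(u, ·) · T)(v₁, …, v_r)`. -/
def covDeriv (h : E → E →L[ℝ] E →L[ℝ] ℝ) {r : ℕ} (T : E → E [×r]→L[ℝ] E) (x : E) :
    E [×(r + 1)]→L[ℝ] E :=
  (fderiv ℝ T x + act (T x) ∘L christoffel h x).uncurryLeft

/-- The `k`-th iterated covariant derivative `∇ᵏR` of the curvature in coordinates. The first `k`
arguments are the directions of differentiation, the last three are those of `R`:
`nablaCurv h k x (u_k, …, u₁, y, z, w) = (∇ᵏ_{u_k, …, u₁} R)(y, z) w`. -/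
def nablaCurv (h : E → E →L[ℝ] E →L[ℝ] ℝ) : (k : ℕ) → E → E [×(3 + k)]→L[ℝ] E
  | 0 => fun x ↦ uncurry₃ (curv h x)
  | k + 1 => covDeriv h (nablaCurv h k)

/-- The curve `c` solves the geodesic equation `c'' + Γ(c', c') = 0` near the parameter `t`. -/
def IsGeodesicNear (h : E → E →L[ℝ] E →L[ℝ] ℝ) (c : ℝ → E) (t : ℝ) : Prop :=
  ∀ᶠ s in 𝓝 t, DifferentiableAt ℝ c s ∧
    HasDerivAt (deriv c) (- christoffel h (c s) (deriv c s) (deriv c s)) s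

/-- The endomorphism field `A` along the curve `c` is differentiable at `t`, with covariant
derivative `(∇A/dt)(t) = A'(t) + [Γ(c'(t), ·), A(t)]` equal to `B`. -/
def HasCovDerivAlongAt (h : E → E →L[ℝ] E →L[ℝ] ℝ) (c : ℝ → E) (A : ℝ → E →L[ℝ] E)
    (B : E →L[ℝ] E) (t : ℝ) : Prop :=
  DifferentiableAt ℝ A t ∧
    deriv A t + (christoffel h (c t) (deriv c t) ∘L A t
      - A t ∘L christoffel h (c t) (deriv c t)) = B

/-- The Jacobi operator `y ↦ R(y, c'(t)) c'(t)` along a curve `c`. -/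
def jacobiOp (h : E → E →L[ℝ] E →L[ℝ] ℝ) (c : ℝ → E) (t : ℝ) : E →L[ℝ] E :=
  ((curv h (c t)).flip (deriv c t)).flip (deriv c t)

theorem jacobiOp_apply (h : E → E →L[ℝ] E →L[ℝ] ℝ) (c : ℝ → E) (t : ℝ) (y : E) :
    jacobiOp h c t y = curv h (c t) y (deriv c t) (deriv c t) := rfl

end Coord

/-! ## Polynomial functions on a vector space -/

section Poly

variable (V : Type*) [AddCommGroup V] [Module ℝ V]

/-- The algebra `𝒫(V)` of real polynomial functions on `V`: the algebra of functions generated by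
the linear functionals. -/
def PolyFun : Subalgebra ℝ (V → ℝ) :=
  Algebra.adjoin ℝ {f : V → ℝ | ∃ φ : V →ₗ[ℝ] ℝ, f = φ}

variable {V}

/-- `f` is a homogeneous polynomial function of degree `i`, `f ∈ 𝒫ⁱ(V)`: the restriction of an
`i`-linear form to the diagonal. -/
def IsHomogeneousFun (i : ℕ) (f : V → ℝ) : Prop :=
  ∃ φ : MultilinearMap ℝ (fun _ : Fin i ↦ V) ℝ, ∀ X, f X = φ (fun _ ↦ X)

/-- A polynomial `P = ∑ i, a_i λ^(k-i)` of degree `k` over `𝒫(V)` is homogeneous if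
`a_i ∈ 𝒫ⁱ(V)` for `i = 0, …, k`. -/
def IsHomogeneousPoly (P : Polynomial (PolyFun V)) : Prop :=
  ∀ i ≤ P.natDegree, IsHomogeneousFun i (P.coeff (P.natDegree - i) : V → ℝ)

/-- The specialization `P(X) ∈ ℝ[λ]` of `P ∈ 𝒫(V)[λ]` at `X ∈ V`: all the coefficients are
evaluated at `X`. -/
def specialize (P : Polynomial (PolyFun V)) (X : V) : Polynomial ℝ :=
  P.map ((Pi.evalRingHom (fun _ : V ↦ ℝ) X).comp (PolyFun V).val.toRingHom)

end Poly

/-! ## Curvature, geodesics and `ℭ₀`-spaces -/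

namespace PseudoRiemannianMetric

variable {E : Type*} [NormedAddCommGroup E] [NormedSpace ℝ E]
  {M : Type*} [TopologicalSpace M] [ChartedSpace E M]

/-- The coordinates of tangent vectors at `q` in the chart `e`. -/
def toCoord (e : OpenPartialHomeomorph M E) (q : M) : TangentSpace 𝓘(ℝ, E) q →L[ℝ] E :=
  mfderiv 𝓘(ℝ, E) 𝓘(ℝ, E) e q

/-- The tangent vector at `q` with given coordinates in the chart `e`. -/
def ofCoord (e : OpenPartialHomeomorph M E) (q : M) : E →L[ℝ] TangentSpace 𝓘(ℝ, E) q :=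
  (toCoord e q).inverse

variable [IsManifold 𝓘(ℝ, E) ∞ M] (g : PseudoRiemannianMetric E M)

/-- The coordinate expression of the metric in the chart `e`; meaningful on `e.target`. -/
def coordMetric (e : OpenPartialHomeomorph M E) (x : E) : E →L[ℝ] E →L[ℝ] ℝ :=
  (ContinuousLinearMap.precomp ℝ (ofCoord e (e.symm x))).comp
    ((g.inner (e.symm x)).comp (ofCoord e (e.symm x)))

theorem coordMetric_apply (e : OpenPartialHomeomorph M E) (x u v : E) :
    g.coordMetric e x u v =
      g.inner (e.symm x) (ofCoord e (e.symm x) u) (ofCoord e (e.symm x) v) := rfl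

/-- The tensor `∇ᵏR` at the point `p`, computed in the preferred chart at `p`. -/
def nablaCurv (k : ℕ) (p : M) :
    ContinuousMultilinearMap ℝ (fun _ : Fin (3 + k) ↦ TangentSpace 𝓘(ℝ, E) p)
      (TangentSpace 𝓘(ℝ, E) p) :=
  (ofCoord (chartAt E p) p).compContinuousMultilinearMap
    ((Coord.nablaCurv (g.coordMetric (chartAt E p)) k (chartAt E p p)).compContinuousLinearMap
      (fun _ ↦ toCoord (chartAt E p) p))

/-- The symmetrized `k`-th covariant derivative of the curvature,
`ℛᵏ(X) Y = (∇ᵏ_{X, …, X} R)(Y, X) X`. -/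
def symmCurv (k : ℕ) (p : M) (X : TangentSpace 𝓘(ℝ, E) p) :
    TangentSpace 𝓘(ℝ, E) p →L[ℝ] TangentSpace 𝓘(ℝ, E) p :=
  (g.nablaCurv k p).toContinuousLinearMap (fun _ ↦ X) ⟨k, by omega⟩

/-- The Ricci tensor `Ric(X, Y) = tr (Z ↦ R(Z, X) Y)` at `p`. -/
def ricci (p : M) (X Y : TangentSpace 𝓘(ℝ, E) p) : ℝ :=
  LinearMap.trace ℝ (TangentSpace 𝓘(ℝ, E) p)
    ((g.nablaCurv 0 p).toContinuousLinearMap ![0, X, Y] 0).toLinearMap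

/-- `γ` is a geodesic on `I`: near every parameter in `I` it stays in some chart of the atlas, in
which it satisfies the geodesic equation. As that equation does not depend on the chart, it then
holds in all charts. -/
def IsGeodesicOn (γ : ℝ → M) (I : Set ℝ) : Prop :=
  ∀ t ∈ I, ∃ e ∈ atlas E M, (∀ᶠ s in 𝓝 t, γ s ∈ e.source) ∧
    Coord.IsGeodesicNear (g.coordMetric e) (fun s ↦ e (γ s)) t

/-- The coordinate expression in the chart `e` of an endomorphism field `C` along `γ`. -/
def coordEndo (e : OpenPartialHomeomorph M E) (γ : ℝ → M)
    (C : ∀ t, TangentSpace 𝓘(ℝ, E) (γ t) →L[ℝ] TangentSpace 𝓘(ℝ, E) (γ t)) (t : ℝ) :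
    E →L[ℝ] E :=
  toCoord e (γ t) ∘L C t ∘L ofCoord e (γ t)

/-- `(M, g)` is a `ℭ₀`-space: along every geodesic `γ : I → M`, where `I` is an open interval, there
is a skew-symmetric endomorphism field `C` that is parallel, `∇C/dt = 0`, and satisfies
`∇R_γ/dt = [C, R_γ]` for the Jacobi operator `R_γ`. The last two equations are expressed in all
charts of the atlas. -/
def IsCZeroSpace : Prop :=
  ∀ (I : Set ℝ) (γ : ℝ → M), IsOpen I → I.OrdConnected → g.IsGeodesicOn γ I →
    ∃ C : ∀ t, TangentSpace 𝓘(ℝ, E) (γ t) →L[ℝ] TangentSpace 𝓘(ℝ, E) (γ t),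
      (∀ t ∈ I, ∀ u v, g.inner (γ t) (C t u) v = - g.inner (γ t) u (C t v)) ∧
      ∀ e ∈ atlas E M, ∀ t ∈ I, γ t ∈ e.source →
        Coord.HasCovDerivAlongAt (g.coordMetric e) (fun s ↦ e (γ s)) (coordEndo e γ C) 0 t ∧
        Coord.HasCovDerivAlongAt (g.coordMetric e) (fun s ↦ e (γ s))
          (Coord.jacobiOp (g.coordMetric e) (fun s ↦ e (γ s)))
          (coordEndo e γ C t ∘L Coord.jacobiOp (g.coordMetric e) (fun s ↦ e (γ s)) t
            - Coord.jacobiOp (g.coordMetric e) (fun s ↦ e (γ s)) t ∘L coordEndo e γ C t) t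

/-- The metric is positive definite. -/
def IsPosDef : Prop :=
  ∀ (q : M) (v : TangentSpace 𝓘(ℝ, E) q), v ≠ 0 → 0 < g.inner q v v

/-! ## The minimal polynomial -/

/-- The evaluation map `𝒫(T_pM)[λ] → 𝒫(T_pM; End T_pM)`, `∑ i, b_i λ^i ↦ ∑ i, b_i ℛⁱ`. -/
def evalCurv (p : M) (P : Polynomial (PolyFun (TangentSpace 𝓘(ℝ, E) p)))
    (X : TangentSpace 𝓘(ℝ, E) p) :
    TangentSpace 𝓘(ℝ, E) p →L[ℝ] TangentSpace 𝓘(ℝ, E) p :=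
  P.sum fun i b ↦ (b : TangentSpace 𝓘(ℝ, E) p → ℝ) X • g.symmCurv i p X

/-- The set `U(p)` of all `X ∈ T_pM` for which `ℛ⁰(X), …, ℛᵏ⁻¹(X)` are linearly independent,
where `k` is the degree of the minimal polynomial. -/
def regularSet (p : M) (k : ℕ) : Set (TangentSpace 𝓘(ℝ, E) p) :=
  {X | LinearIndependent ℝ (fun j : Fin k ↦ g.symmCurv j p X)}

/-- `P` is an admissible polynomial at `p`: monic, homogeneous and in the kernel of the
evaluation map. -/
def IsAdmissible (p : M) (P : Polynomial (PolyFun (TangentSpace 𝓘(ℝ, E) p))) : Prop :=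
  P.Monic ∧ IsHomogeneousPoly P ∧ ∀ X, g.evalCurv p P X = 0

/-- `P` is the minimal polynomial of `(M, g)` at `p`: it is admissible and `U(p)` is nonempty. -/
def IsMinimalPolynomial (p : M) (P : Polynomial (PolyFun (TangentSpace 𝓘(ℝ, E) p))) : Prop :=
  g.IsAdmissible p P ∧ (g.regularSet p P.natDegree).Nonempty

end PseudoRiemannianMetric

end

/-! Take the geodesic with initial velocity `X`. Its velocity is parallel, so the covariant
derivative of `ℛᵏ(γ')` along it is `ℛᵏ⁺¹(γ')`. Since `C` is parallel too, differentiating `∇R_γ/dt =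
[C, R_γ]` repeatedly gives `ℛᵏ⁺¹(X) = [C, ℛᵏ(X)]` for every `k`, with one and the same skew
endomorphism `C` of `T_pM` (`exists_skew_symmCurv_succ`). Hence `ℛᵏ(X) = ad(C)ᵏ ℛ⁰(X)`, and the
defining relation says that the specialization at `X`, evaluated at `ad C`, kills `ℛ⁰(X)`.

(a) For positive definite `g`, `ad C` is skew-adjoint for the Hermitian form `tr(A* B)` on
complexified endomorphisms, so its eigenvalues are imaginary and it has no Jordan blocks. For `X ∈
U(p)` no nonzero polynomial of smaller degree kills `ℛ⁰(X)`. Splitting off one linear factor at a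
root therefore leaves an eigenvector, which makes the root imaginary; a double root could be lowered
to a simple one, against minimality (`root_of_skewHermitian_aeval`,
`root_of_skew_iterated_commutator`).

(b) Commutators are traceless, so the trace of the relation reduces to `a_k(X) Ric(X, X) = 0`. As
`Ric` is symmetric, `Ric ≠ 0` makes its quadratic form nonzero, and a product of polynomial
functions vanishes only if one factor does (`trace_curv_symm`, `eq_zero_of_mul_bilin_eq_zero`). -/

/-! ### Commutators with a skew-Hermitian matrix -/

section SkewHermitian

open Matrix Polynomial
open scoped ComplexOrder

variable {n : Type*} [Fintype n] [DecidableEq n]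

/-- The commutator with a fixed matrix `S`. -/
noncomputable def matrixAd (S : Matrix n n ℂ) : Module.End ℂ (Matrix n n ℂ) :=
  LinearMap.mulLeft ℂ S - LinearMap.mulRight ℂ S

theorem matrixAd_apply (S X : Matrix n n ℂ) : matrixAd S X = S * X - X * S := by
  simp [matrixAd]

/-- Cyclicity of the trace makes `ad S` skew-adjoint for the positive definite form `tr(Xᴴ Y)`. The
next two lemmas are the spectral consequences. -/
theorem trace_conjTranspose_matrixAd_mul {S : Matrix n n ℂ} (hS : Sᴴ = -S) (X Y : Matrix n n ℂ) :
    ((matrixAd S X)ᴴ * Y).trace = -(Xᴴ * matrixAd S Y).trace := by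
  simp only [matrixAd_apply, conjTranspose_sub, conjTranspose_mul, hS, mul_sub, sub_mul,
    trace_sub, mul_neg, neg_mul, trace_neg, ← mul_assoc]
  rw [Matrix.trace_mul_comm (Xᴴ * Y) S, ← mul_assoc]
  ring

theorem re_eq_zero_of_matrixAd_eq_smul {S : Matrix n n ℂ} (hS : Sᴴ = -S) {X : Matrix n n ℂ}
    (hX : X ≠ 0) {z : ℂ} (h : matrixAd S X = z • X) : z.re = 0 := by
  have h0 : (Xᴴ * X).trace ≠ 0 := mt trace_conjTranspose_mul_self_eq_zero_iff.1 hX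
  have h1 := trace_conjTranspose_matrixAd_mul hS X X
  rw [h, conjTranspose_smul, smul_mul_assoc, mul_smul_comm, trace_smul, trace_smul, smul_eq_mul,
    smul_eq_mul] at h1
  have h2 : (star z + z) * (Xᴴ * X).trace = 0 := by linear_combination h1
  have h3 := (mul_eq_zero.1 h2).resolve_right h0
  have h4 := congrArg Complex.re h3
  simp at h4
  linarith

/-- Absence of Jordan blocks: for imaginary `z` the operator `ad S - z` is again skew-adjoint, so `Y
= (ad S - z) X` has norm `tr(Yᴴ Y) = -tr(Xᴴ (ad S - z) Y) = 0`. -/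
theorem matrixAd_eq_smul_of_sq {S : Matrix n n ℂ} (hS : Sᴴ = -S) {X : Matrix n n ℂ}
    {z : ℂ} (hz : z.re = 0)
    (h : matrixAd S (matrixAd S X - z • X) = z • (matrixAd S X - z • X)) :
    matrixAd S X = z • X := by
  have hz' : star z = -z := by
    apply Complex.ext <;> simp [hz]
  set Y := matrixAd S X - z • X with hY
  have h0 : (Yᴴ * Y).trace = 0 := by
    have : (Yᴴ * Y).trace = ((matrixAd S X)ᴴ * Y).trace - star z * (Xᴴ * Y).trace := by
      conv_lhs => rw [hY]
      rw [conjTranspose_sub, sub_mul, trace_sub, conjTranspose_smul, smul_mul_assoc, trace_smul,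
        smul_eq_mul, ← hY]
    rw [this, trace_conjTranspose_matrixAd_mul hS, h, mul_smul_comm, trace_smul, smul_eq_mul, hz']
    ring
  exact sub_eq_zero.1 (trace_conjTranspose_mul_self_eq_zero_iff.1 h0)

/-- If `w, D w, …, D^(k-1) w` are linearly independent and the commutator operator `D` with a
skew-Hermitian matrix is annihilated on `w` by a polynomial `P` of degree `k`, then the roots of `P`
are purely imaginary and simple. -/
theorem root_of_skewHermitian_aeval {S : Matrix n n ℂ} (hS : Sᴴ = -S) (w : Matrix n n ℂ)
    {P : ℂ[X]} (hP : P ≠ 0) (hPw : aeval (matrixAd S) P w = 0)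
    (hind : ∀ Q : ℂ[X], Q.degree < P.degree → aeval (matrixAd S) Q w = 0 → Q = 0)
    {z : ℂ} (hz : P.IsRoot z) : z.re = 0 ∧ P.rootMultiplicity z = 1 := by
  have key : ∀ (R : ℂ[X]), aeval (matrixAd S) ((X - C z) * R) w
      = matrixAd S (aeval (matrixAd S) R w) - z • aeval (matrixAd S) R w := by
    intro R
    simp [Algebra.algebraMap_eq_smul_one]
  have hdeg : ∀ R : ℂ[X], P = (X - C z) * R → R.degree < P.degree := by
    intro R hR
    have hR0 : R ≠ 0 := by
      rintro rfl
      exact hP (by simpa using hR)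
    rw [hR, degree_mul, degree_X_sub_C, degree_eq_natDegree hR0]
    exact_mod_cast Nat.lt_one_add_iff.2 le_rfl
  have hre : z.re = 0 := by
    obtain ⟨Q, hQ⟩ := dvd_iff_isRoot.2 hz
    have hQ0 : Q ≠ 0 := by
      rintro rfl
      exact hP (by simpa using hQ)
    -- With `P = (X - z) Q`, the matrix `Q(ad S) w` is nonzero by minimality of the degree, hence an
    -- eigenvector for `z`.
    refine re_eq_zero_of_matrixAd_eq_smul hS (X := aeval (matrixAd S) Q w) (z := z)
      (fun h ↦ hQ0 (hind Q (hdeg Q hQ) h)) ?_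
    rw [hQ, key] at hPw
    exact sub_eq_zero.1 hPw
  refine ⟨hre, le_antisymm ?_ ((rootMultiplicity_pos hP).2 hz)⟩
  -- If `P = (X - z)² R`, semisimplicity shows that already `(X - z) R` annihilates `w`, although
  -- its degree is too small.
  by_contra! hlt
  obtain ⟨R, hR⟩ := (pow_dvd_pow (X - C z) hlt).trans (pow_rootMultiplicity_dvd P z)
  have hPR : P = (X - C z) * ((X - C z) * R) := by rw [hR]; ring
  have hne : (X - C z) * R ≠ 0 := fun h ↦ hP (by rw [hPR, h, mul_zero])
  refine hne (hind _ (hdeg _ hPR) ?_)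
  rw [hPR, key, key] at hPw
  rw [key, sub_eq_zero]
  exact matrixAd_eq_smul_of_sq hS hre (sub_eq_zero.1 hPw)

end SkewHermitian

/-! ### Skew endomorphisms of a Euclidean space -/

section PosDef

open Polynomial

theorem exists_basis_orthonormal_of_posDef {V : Type*} [AddCommGroup V] [Module ℝ V]
    [FiniteDimensional ℝ V] (B : V →ₗ[ℝ] V →ₗ[ℝ] ℝ) (hsymm : ∀ v w, B v w = B w v)
    (hpos : ∀ v, v ≠ 0 → 0 < B v v) :
    ∃ b : Module.Basis (Fin (Module.finrank ℝ V)) ℝ V,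
      ∀ i j, B (b i) (b j) = if i = j then 1 else 0 := by
  let core : InnerProductSpace.Core ℝ V :=
    { inner := fun v w ↦ B v w
      conj_inner_symm := fun v w ↦ by simp [hsymm v w]
      re_inner_nonneg := fun v ↦ by
        rcases eq_or_ne v 0 with rfl | hv
        · simp
        · simpa using (hpos v hv).le
      add_left := fun u v w ↦ by simp
      smul_left := fun u v r ↦ by simp
      definite := fun v hv ↦ by
        by_contra h
        exact (hpos v h).ne' hv }
  let _ : NormedAddCommGroup V := core.toNormedAddCommGroup
  let _ : InnerProductSpace ℝ V := InnerProductSpace.ofCore core.toCore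
  refine ⟨(stdOrthonormalBasis ℝ V).toBasis, fun i j ↦ ?_⟩
  simpa using! orthonormal_iff_ite.1 (stdOrthonormalBasis ℝ V).orthonormal i j

theorem toMatrix_transpose_eq_neg_of_skew {V : Type*} [AddCommGroup V] [Module ℝ V]
    {n : Type*} [Fintype n] [DecidableEq n]
    (B : V →ₗ[ℝ] V →ₗ[ℝ] ℝ) (b : Module.Basis n ℝ V)
    (hb : ∀ i j, B (b i) (b j) = if i = j then 1 else 0) (C : V →ₗ[ℝ] V)
    (hC : ∀ v w, B (C v) w = - B v (C w)) :
    (LinearMap.toMatrix b b C).transpose = -LinearMap.toMatrix b b C := by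
  have hr : ∀ v j, B v (b j) = b.repr v j := by
    intro v j
    conv_lhs => rw [← b.sum_repr v]
    simp only [map_sum, map_smul, LinearMap.sum_apply, LinearMap.smul_apply, smul_eq_mul, hb]
    simp
  have hl : ∀ v j, B (b j) v = b.repr v j := by
    intro v j
    conv_lhs => rw [← b.sum_repr v]
    simp only [map_sum, map_smul, smul_eq_mul, hb]
    simp
  ext i j
  simp only [Matrix.transpose_apply, LinearMap.toMatrix_apply, Matrix.neg_apply]
  rw [← hr, hC, hl]

/-- Let `T, [C, T], [C, [C, T]], …` be the iterated commutators of an endomorphism `T` with an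
endomorphism `C` that is skew-symmetric with respect to a positive definite form. The
minimal relation between them has purely imaginary and simple roots. -/
theorem root_of_skew_iterated_commutator {V : Type*} [AddCommGroup V] [Module ℝ V]
    [FiniteDimensional ℝ V] (B : V →ₗ[ℝ] V →ₗ[ℝ] ℝ) (hsymm : ∀ v w, B v w = B w v)
    (hpos : ∀ v, v ≠ 0 → 0 < B v v) (C : V →ₗ[ℝ] V) (hC : ∀ v w, B (C v) w = - B v (C w))
    (T : ℕ → V →ₗ[ℝ] V) (hT : ∀ k, T (k + 1) = C ∘ₗ T k - T k ∘ₗ C)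
    (P : ℝ[X]) (hP : P ≠ 0) (hPT : (P.sum fun i a ↦ a • T i) = 0)
    (hind : LinearIndependent ℝ (fun j : Fin P.natDegree ↦ T j)) {z : ℂ}
    (hz : (P.map (algebraMap ℝ ℂ)).IsRoot z) :
    z.re = 0 ∧ (P.map (algebraMap ℝ ℂ)).rootMultiplicity z = 1 := by
  obtain ⟨b, hb⟩ := exists_basis_orthonormal_of_posDef B hsymm hpos
  -- In an orthonormal basis, skewness of `C` becomes skew-Hermitian symmetry of its complexified
  -- matrix.
  let μ : (V →ₗ[ℝ] V) → Matrix (Fin (Module.finrank ℝ V)) (Fin (Module.finrank ℝ V)) ℂ :=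
    fun A ↦ (LinearMap.toMatrix b b A).map (algebraMap ℝ ℂ)
  have hS : (μ C).conjTranspose = -μ C := by
    have h := toMatrix_transpose_eq_neg_of_skew B b hb C hC
    ext i j
    have h' := congrFun (congrFun h i) j
    simp only [Matrix.transpose_apply, Matrix.neg_apply] at h'
    simp [μ, Matrix.conjTranspose_apply, h']
  have hiter : ∀ i, (matrixAd (μ C) ^ i) (μ (T 0)) = μ (T i) := by
    intro i
    induction i with
    | zero => simp
    | succ i ih =>
      rw [pow_succ', Module.End.mul_apply, ih, matrixAd_apply, hT]
      simp only [μ, map_sub, LinearMap.toMatrix_comp b b b, ← Matrix.map_mul]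
      ext i j
      simp
  have haeval : ∀ Q : ℂ[X], aeval (matrixAd (μ C)) Q (μ (T 0)) = Q.sum fun i a ↦ a • μ (T i) := by
    intro Q
    rw [aeval_eq_sum_range, LinearMap.sum_apply, Polynomial.sum_over_range _ (by simp)]
    simp [hiter]
  refine root_of_skewHermitian_aeval hS (μ (T 0)) ((Polynomial.map_ne_zero_iff
    (algebraMap ℝ ℂ).injective).2 hP) ?_ ?_ hz
  · rw [haeval, Polynomial.sum_over_range _ (by simp), natDegree_map]
    rw [Polynomial.sum_over_range _ (by simp)] at hPT
    ext i j
    have h := congrFun (congrFun (congrArg (fun A ↦ LinearMap.toMatrix b b A) hPT) i) j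
    simp only [map_sum, map_smul, Matrix.sum_apply, Matrix.smul_apply, map_zero,
      Matrix.zero_apply, smul_eq_mul] at h
    have h2 := congrArg (algebraMap ℝ ℂ) h
    simp only [Matrix.sum_apply, Matrix.smul_apply, Matrix.zero_apply, coeff_map, μ,
      Matrix.map_apply, smul_eq_mul]
    rw [map_sum] at h2
    simpa using h2
  · intro Q hQ h
    rw [haeval] at h
    by_contra hQ0
    have hQn : Q.natDegree < P.natDegree := by
      rw [degree_map] at hQ
      exact natDegree_lt_natDegree hQ0 hQ
    rw [Polynomial.sum_over_range' _ (by simp) _ hQn] at h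
    -- The `T j` are independent only over `ℝ`. Their matrices are real, so any real functional `f`
    -- turns the complex relation into a real one; real and imaginary part together recover the
    -- coefficients.
    have hpart : ∀ f : ℂ →ₗ[ℝ] ℝ, ∀ k < P.natDegree, f (Q.coeff k) = 0 := by
      intro f
      have hsum : ∑ j : Fin P.natDegree, f (Q.coeff j) • T j = 0 := by
        apply (LinearMap.toMatrix b b).injective
        ext i j
        have h' := congrArg f (congrFun (congrFun h i) j)
        rw [Finset.sum_range, Matrix.sum_apply, map_sum] at h'
        simp only [map_sum, map_smul, Matrix.sum_apply, Matrix.smul_apply, map_zero,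
          Matrix.zero_apply, smul_eq_mul] at h' ⊢
        rw [← h']
        refine Finset.sum_congr rfl fun k _ ↦ ?_
        have : Q.coeff k * μ (T k) i j = (LinearMap.toMatrix b b (T k) i j) • Q.coeff k := by
          simp [μ, mul_comm]
        rw [this, map_smul, smul_eq_mul, mul_comm]
      intro k hk
      exact Fintype.linearIndependent_iff.1 hind _ hsum ⟨k, hk⟩
    refine hQ0 (Polynomial.ext fun k ↦ ?_)
    rcases lt_or_ge k P.natDegree with hk | hk
    · exact Complex.ext (hpart Complex.reLm k hk) (hpart Complex.imLm k hk)
    · rw [coeff_eq_zero_of_natDegree_lt (hQn.trans_le hk), coeff_zero]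

end PosDef

/-! ### Smoothness of the coordinate tensors -/

namespace Coord

set_option maxSynthPendingDepth 3

variable {E : Type*} [NormedAddCommGroup E] [NormedSpace ℝ E]

section Smoothness

variable {h : E → E →L[ℝ] E →L[ℝ] ℝ} {x : E}

theorem contDiffAt_christoffelFirst (hh : ContDiffAt ℝ ∞ h x) :
    ContDiffAt ℝ ∞ (christoffelFirst h) x := by
  have hD : ContDiffAt ℝ ∞ (fderiv ℝ h) x := hh.fderiv_right (by simp)
  have hflip : ContDiffAt ℝ ∞ (fun y ↦ (fderiv ℝ h y).flip) x :=
    (ContinuousLinearMap.flipₗᵢ ℝ E E (E →L[ℝ] ℝ)).contDiff.contDiffAt.comp x hD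
  unfold christoffelFirst
  exact ((hD.add hflip).sub (contDiffAt_const.clm_comp hflip)).const_smul _

/-- Over a complete space `ContinuousLinearMap.inverse` is smooth at every invertible operator, so
invertibility at the single point `x` suffices. -/
theorem contDiffAt_christoffel [CompleteSpace E] (hh : ContDiffAt ℝ ∞ h x)
    (hinv : (h x).IsInvertible) : ContDiffAt ℝ ∞ (christoffel h) x := by
  have hi : ContDiffAt ℝ ∞ (fun y ↦ (h y).inverse) x := hinv.contDiffAt_map_inverse.comp x hh
  exact ((ContinuousLinearMap.compL ℝ E (E →L[ℝ] ℝ) E).contDiff.contDiffAt.comp x hi).clm_comp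
    (contDiffAt_christoffelFirst hh)

theorem contDiffAt_curv (hΓ : ContDiffAt ℝ ∞ (christoffel h) x) :
    ContDiffAt ℝ ∞ (curv h) x := by
  have hhalf : ContDiffAt ℝ ∞ (halfCurv h) x := by
    refine (hΓ.fderiv_right (by simp)).add ?_
    change ContDiffAt ℝ ∞ (fun y ↦ ((ContinuousLinearMap.compL ℝ E E E ∘L
      christoffel h y).flip ∘L christoffel h y).flip) x
    have h1 : ContDiffAt ℝ ∞ (fun y ↦ (ContinuousLinearMap.compL ℝ E E E ∘L
      christoffel h y).flip) x :=
      (ContinuousLinearMap.flipₗᵢ ℝ E (E →L[ℝ] E) (E →L[ℝ] E)).contDiff.contDiffAt.comp x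
        (contDiffAt_const.clm_comp hΓ)
    exact (ContinuousLinearMap.flipₗᵢ ℝ E E (E →L[ℝ] E)).contDiff.contDiffAt.comp x
      (h1.clm_comp hΓ)
  exact hhalf.sub ((ContinuousLinearMap.flipₗᵢ ℝ E E (E →L[ℝ] E)).contDiff.contDiffAt.comp x hhalf)

theorem contDiffAt_covDeriv (hΓ : ContDiffAt ℝ ∞ (christoffel h) x) {r : ℕ}
    {T : E → E [×r]→L[ℝ] E} (hT : ContDiffAt ℝ ∞ T x) : ContDiffAt ℝ ∞ (covDeriv h T) x := by
  have hact : ContDiffAt ℝ ∞ (fun y ↦ act (T y)) x :=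
    ((ContinuousLinearMap.contDiff _).contDiffAt.comp x hT).sub
      (ContDiffAt.sum fun i _ ↦ (ContinuousLinearMap.contDiff _).contDiffAt.comp x hT)
  exact (continuousMultilinearCurryLeftEquiv ℝ (fun _ : Fin (r + 1) ↦ E)
    E).symm.contDiff.contDiffAt.comp x ((hT.fderiv_right (by simp)).add (hact.clm_comp hΓ))

theorem contDiffAt_nablaCurv (hΓ : ContDiffAt ℝ ∞ (christoffel h) x) (k : ℕ) :
    ContDiffAt ℝ ∞ (nablaCurv h k) x := by
  induction k with
  | zero =>
    exact (continuousMultilinearCurryLeftEquiv ℝ (fun _ : Fin 3 ↦ E)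
      E).symm.contDiff.contDiffAt.comp x
        (contDiffAt_const.clm_comp (contDiffAt_const.clm_comp (contDiffAt_curv hΓ)))
  | succ k ih => exact contDiffAt_covDeriv hΓ ih

end Smoothness

/-! ### Symmetries of the curvature and of the Ricci tensor -/

section Metric

variable {h : E → E →L[ℝ] E →L[ℝ] ℝ} {x : E}

theorem metric_christoffel (hinv : (h x).IsInvertible) (u v w : E) :
    h x (christoffel h x u v) w =
      (1 / 2) * (fderiv ℝ h x u v w + fderiv ℝ h x v u w - fderiv ℝ h x w u v) := by
  rw [christoffel_apply, hinv.self_apply_inverse, christoffelFirst_apply]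

theorem fderiv_metric_symm (hh : DifferentiableAt ℝ h x)
    (hsymm : ∀ᶠ y in 𝓝 x, ∀ v w, h y v w = h y w v) (u v w : E) :
    fderiv ℝ h x u v w = fderiv ℝ h x u w v := by
  have h1 : ∀ v w, HasFDerivAt (fun y ↦ h y v w) (((fderiv ℝ h x).flip v).flip w) x :=
    fun v w ↦ (hh.hasFDerivAt.clm_apply (hasFDerivAt_const v x)).clm_apply
      (hasFDerivAt_const w x) |>.congr_fderiv (by ext; simp)
  have h2 := ((h1 v w).congr_of_eventuallyEq (hsymm.mono fun y hy ↦ hy w v)).unique (h1 w v)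
  simpa using congrArg (fun L ↦ L u) h2

theorem christoffel_symm (hh : DifferentiableAt ℝ h x)
    (hsymm : ∀ᶠ y in 𝓝 x, ∀ v w, h y v w = h y w v) (u v : E) :
    christoffel h x u v = christoffel h x v u := by
  rw [christoffel_apply, christoffel_apply]
  congr 1
  ext w
  rw [christoffelFirst_apply, christoffelFirst_apply, fderiv_metric_symm hh hsymm w u v]
  ring

/-- The Levi-Civita connection is metric. -/
theorem metric_christoffel_add (hh : DifferentiableAt ℝ h x) (hinv : (h x).IsInvertible)
    (hsymm : ∀ᶠ y in 𝓝 x, ∀ v w, h y v w = h y w v) (u v w : E) :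
    h x (christoffel h x u v) w + h x (christoffel h x u w) v = fderiv ℝ h x u v w := by
  rw [metric_christoffel hinv, metric_christoffel hinv, fderiv_metric_symm hh hsymm u w v,
    fderiv_metric_symm hh hsymm v u w, fderiv_metric_symm hh hsymm w u v]
  ring

theorem hasFDerivAt_apply₃ {T : E → E →L[ℝ] E →L[ℝ] E} {T' : E →L[ℝ] E →L[ℝ] E →L[ℝ] E}
    (hT : HasFDerivAt T T' x) (u v : E) : HasFDerivAt (fun y ↦ T y u v) ((T'.flip u).flip v) x :=
  (hT.clm_apply (hasFDerivAt_const u x)).clm_apply (hasFDerivAt_const v x) |>.congr_fderiv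
    (by ext; simp)

/-- The curvature endomorphisms `R(a, u)` are skew-symmetric. -/
theorem metric_curv_skew [CompleteSpace E] (hh : ContDiffAt ℝ ∞ h x)
    (hinv : ∀ᶠ y in 𝓝 x, (h y).IsInvertible)
    (hsymm : ∀ᶠ y in 𝓝 x, ∀ v w, h y v w = h y w v) (a u v w : E) :
    h x (curv h x a u v) w + h x (curv h x a u w) v = 0 := by
  have hd : DifferentiableAt ℝ h x := hh.differentiableAt (by simp)
  have hΓ := ((contDiffAt_christoffel hh hinv.self_of_nhds).differentiableAt (by simp)).hasFDerivAt
  have hD2 : HasFDerivAt (fderiv ℝ h) (fderiv ℝ (fderiv ℝ h) x) x :=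
    ((hh.fderiv_right (m := ∞) (by simp)).differentiableAt (by simp)).hasFDerivAt
  have hdn : ∀ᶠ y in 𝓝 x, DifferentiableAt ℝ h y :=
    ((hh.of_le (m := 1) (by exact_mod_cast le_top)).eventually (by simp)).mono
      fun y hy ↦ hy.differentiableAt (by simp)
  have hsn := hsymm.eventually_nhds
  -- Metric compatibility holds near `x`, so it may be differentiated once more. Antisymmetrizing in
  -- `a` and `u` removes the second derivatives of `h` and leaves the curvature.
  have key : ∀ a u v w : E,
      fderiv ℝ (fderiv ℝ h) x a u v w =
        fderiv ℝ h x a (christoffel h x u v) w + h x (fderiv ℝ (christoffel h) x a u v) w +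
        (fderiv ℝ h x a (christoffel h x u w) v + h x (fderiv ℝ (christoffel h) x a u w) v) := by
    intro a u v w
    have hl : ∀ v w, HasFDerivAt (fun y ↦ h y (christoffel h y u v) w) _ x := fun v w ↦
      (hd.hasFDerivAt.clm_apply (hasFDerivAt_apply₃ hΓ u v)).clm_apply (hasFDerivAt_const w x)
    have hr : HasFDerivAt (fun y ↦ fderiv ℝ h y u v w) _ x :=
      ((hD2.clm_apply (hasFDerivAt_const u x)).clm_apply (hasFDerivAt_const v x)).clm_apply
        (hasFDerivAt_const w x)
    have heq : (fun y ↦ fderiv ℝ h y u v w) =ᶠ[𝓝 x]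
        fun y ↦ h y (christoffel h y u v) w + h y (christoffel h y u w) v := by
      filter_upwards [hdn, hinv, hsn] with y h1 h2 h3
      exact (metric_christoffel_add h1 h2 h3 u v w).symm
    have := congrArg (fun L ↦ L a) (hr.unique (((hl v w).add (hl w v)).congr_of_eventuallyEq heq))
    simp only [add_apply, ContinuousLinearMap.coe_comp, Function.comp_apply,
      ContinuousLinearMap.flip_apply, ContinuousLinearMap.comp_zero, zero_add] at this
    linarith
  have hsym2 : fderiv ℝ (fderiv ℝ h) x a u v w = fderiv ℝ (fderiv ℝ h) x u a v w := by
    have := hh.isSymmSndFDerivAt (by simpa using WithTop.coe_le_coe.2 (le_top (a := (2 : ℕ∞))))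
    rw [this a u]
  have hm := fun u v w ↦ metric_christoffel_add hd hinv.self_of_nhds hsymm u v w
  have hs := hsymm.self_of_nhds
  have k1 := key a u v w
  have k2 := key u a v w
  rw [← hm a, ← hm a] at k1
  rw [← hm u, ← hm u] at k2
  simp only [curv_apply, map_add, map_sub, add_apply, sub_apply]
  have e1 := hs (christoffel h x u v) (christoffel h x a w)
  have e2 := hs (christoffel h x u w) (christoffel h x a v)
  linarith

/-- Lowering an index by `b` conjugates `A` to minus its own transpose on the dual space, and the
trace is invariant under conjugation and transposition. This needs no definiteness. -/
theorem trace_eq_zero_of_skew [FiniteDimensional ℝ E] {b : E →L[ℝ] E →L[ℝ] ℝ}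
    (hb : b.IsInvertible) (hsymm : ∀ v w, b v w = b w v) {A : E →L[ℝ] E}
    (hA : ∀ v w, b (A v) w + b (A w) v = 0) : LinearMap.trace ℝ E A.toLinearMap = 0 := by
  obtain ⟨e, rfl⟩ := hb
  let f : E ≃ₗ[ℝ] Module.Dual ℝ E := e.toLinearEquiv.trans LinearMap.toContinuousLinearMap.symm
  have hf : ∀ v w, f v w = e v w := fun v w ↦ rfl
  have h1 : LinearMap.trace ℝ _ (f.conj A.toLinearMap) = LinearMap.trace ℝ E A.toLinearMap :=
    LinearMap.trace_conj' _ _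
  have h2 : f.conj A.toLinearMap = - Module.Dual.transpose (R := ℝ) A.toLinearMap := by
    apply LinearMap.ext
    intro φ
    obtain ⟨v, rfl⟩ := f.surjective φ
    apply LinearMap.ext
    intro w
    have := hA v w
    have h3 := hsymm (A w) v
    simp only [ContinuousLinearEquiv.coe_coe] at this h3
    simp [LinearEquiv.conj_apply, hf, Module.Dual.transpose_apply]
    linarith
  rw [h2, map_neg, LinearMap.trace_transpose'] at h1
  linarith

/-- The first Bianchi identity. -/
theorem curv_bianchi (hΓ : ContDiffAt ℝ ∞ (christoffel h) x)
    (hsymm : ∀ᶠ y in 𝓝 x, ∀ u v, christoffel h y u v = christoffel h y v u) (u v w : E) :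
    curv h x u v w + curv h x v w u + curv h x w u v = 0 := by
  have hs := hsymm.self_of_nhds
  have hd := (hΓ.differentiableAt (by simp)).hasFDerivAt
  have hs' : ∀ a u v, fderiv ℝ (christoffel h) x a u v = fderiv ℝ (christoffel h) x a v u := by
    intro a u v
    have h2 := ((hasFDerivAt_apply₃ hd u v).congr_of_eventuallyEq
      (hsymm.mono fun y hy ↦ hy v u)).unique (hasFDerivAt_apply₃ hd v u)
    simpa using congrArg (fun L ↦ L a) h2
  simp only [curv_apply]
  rw [hs' u v w, hs' v u w, hs' w v u, hs v w, hs u w, hs u v]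
  abel

/-- The Ricci tensor is symmetric. -/
theorem trace_curv_symm [FiniteDimensional ℝ E] (hh : ContDiffAt ℝ ∞ h x)
    (hinv : ∀ᶠ y in 𝓝 x, (h y).IsInvertible)
    (hsymm : ∀ᶠ y in 𝓝 x, ∀ v w, h y v w = h y w v) (u v : E) :
    LinearMap.trace ℝ E (((curv h x).flip u).flip v).toLinearMap =
      LinearMap.trace ℝ E (((curv h x).flip v).flip u).toLinearMap := by
  have : CompleteSpace E := FiniteDimensional.complete ℝ E
  have hdn : ∀ᶠ y in 𝓝 x, DifferentiableAt ℝ h y :=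
    ((hh.of_le (m := 1) (by exact_mod_cast le_top)).eventually (by simp)).mono
      fun y hy ↦ hy.differentiableAt (by simp)
  have hΓs : ∀ᶠ y in 𝓝 x, ∀ u v, christoffel h y u v = christoffel h y v u := by
    filter_upwards [hdn, hsymm.eventually_nhds] with y h1 h2
    exact christoffel_symm h1 h2
  have h0 : LinearMap.trace ℝ E (curv h x u v).toLinearMap = 0 :=
    trace_eq_zero_of_skew hinv.self_of_nhds hsymm.self_of_nhds
      (metric_curv_skew hh hinv hsymm u v)
  -- By Bianchi the two contracted operators differ by `R(u, v)`, which is skew and hence traceless.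
  have h1 : (((curv h x).flip u).flip v).toLinearMap - (((curv h x).flip v).flip u).toLinearMap
      = -(curv h x u v).toLinearMap := by
    ext w
    have hB := curv_bianchi (contDiffAt_christoffel hh hinv.self_of_nhds) hΓs u v w
    have hskew : curv h x v w u = - curv h x w v u := by
      rw [curv_apply, curv_apply]; abel
    rw [hskew] at hB
    simp only [LinearMap.sub_apply, ContinuousLinearMap.coe_coe, ContinuousLinearMap.flip_apply,
      LinearMap.neg_apply]
    rw [sub_eq_iff_eq_add, neg_add_eq_sub, eq_sub_iff_add_eq, ← sub_eq_zero, ← hB]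
    abel
  have h2 := congrArg (LinearMap.trace ℝ E) h1
  rw [map_sub, map_neg, h0, neg_zero] at h2
  exact sub_eq_zero.1 h2

end Metric

end Coord

/-! ### Covariant differentiation along geodesics -/

namespace Coord

variable {E : Type*} [NormedAddCommGroup E] [NormedSpace ℝ E]

set_option maxSynthPendingDepth 3

section AlongCurve

/-- In finite dimension a basis identifies operators with tuples of values, so derivatives of
operator-valued curves can be computed on fixed vectors. -/
theorem hasDerivAt_clm_of_apply [FiniteDimensional ℝ E] {F : Type*} [NormedAddCommGroup F]
    [NormedSpace ℝ F] {J : ℝ → E →L[ℝ] F} {J' : E →L[ℝ] F} {t : ℝ}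
    (hJ : ∀ y, HasDerivAt (fun s ↦ J s y) (J' y) t) : HasDerivAt J J' t := by
  let d := Module.finrank ℝ E
  have hd : d = Module.finrank ℝ (Fin d → ℝ) := (Module.finrank_fin_fun ℝ).symm
  let e₁ := ContinuousLinearEquiv.ofFinrankEq hd
  let e₂ := (e₁.arrowCongr (1 : F ≃L[ℝ] F)).trans (ContinuousLinearEquiv.piRing (Fin d))
  have h1 : HasDerivAt (fun s ↦ e₂ (J s)) (e₂ J') t := hasDerivAt_pi.2 fun i ↦ hJ _
  have h2 := e₂.symm.hasFDerivAt.comp_hasDerivAt t h1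
  rw [show ⇑(e₂.symm : (Fin d → F) →L[ℝ] (E →L[ℝ] F)) (e₂ J') = J' from
    e₂.symm_apply_apply J'] at h2
  exact h2.congr_of_eventuallyEq (.of_forall fun s ↦ (e₂.symm_apply_apply (J s)).symm)

variable {h : E → E →L[ℝ] E →L[ℝ] ℝ} {c : ℝ → E} {t : ℝ}

/-- The commutator of two differentiable endomorphism fields satisfies the product rule. -/
theorem HasCovDerivAlongAt.commutator {A A' : ℝ → E →L[ℝ] E} {B B' : E →L[ℝ] E}
    (hA : HasCovDerivAlongAt h c A B t) (hA' : HasCovDerivAlongAt h c A' B' t) :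
    HasCovDerivAlongAt h c (fun s ↦ A s ∘L A' s - A' s ∘L A s)
      ((B ∘L A' t + A t ∘L B') - (B' ∘L A t + A' t ∘L B)) t := by
  have h1 := hA.1.hasDerivAt.clm_comp hA'.1.hasDerivAt
  have h2 := hA'.1.hasDerivAt.clm_comp hA.1.hasDerivAt
  refine ⟨(h1.sub h2).differentiableAt, ?_⟩
  have h3 := (h1.sub h2).deriv
  rw [show deriv (fun s ↦ A s ∘L A' s - A' s ∘L A s) t = _ from h3, ← hA.2, ← hA'.2]
  ext y
  simp
  abel

theorem HasCovDerivAlongAt.congr {A A' : ℝ → E →L[ℝ] E} {B : E →L[ℝ] E}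
    (hA : HasCovDerivAlongAt h c A B t) (hAA' : A' =ᶠ[𝓝 t] A) :
    HasCovDerivAlongAt h c A' B t :=
  ⟨hA.1.congr_of_eventuallyEq hAA', by rw [hAA'.deriv_eq, hAA'.eq_of_nhds]; exact hA.2⟩

theorem IsGeodesicNear.congr {c' : ℝ → E} (hc : IsGeodesicNear h c t) (hcc' : c' =ᶠ[𝓝 t] c) :
    IsGeodesicNear h c' t := by
  filter_upwards [hc, hcc'.eventually_nhds] with s h1 h2
  have h2 : c' =ᶠ[𝓝 s] c := h2
  refine ⟨h1.1.congr_of_eventuallyEq h2, ?_⟩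
  rw [h2.deriv_eq, h2.eq_of_nhds]
  exact h1.2.congr_of_eventuallyEq h2.deriv

/-- Along a geodesic, `∇/dt` of `y ↦ T(c', …, y, …, c')` is `y ↦ (∇_{c'}T)(c', …, y, …, c')`. -/
theorem hasCovDerivAlongAt_velocity [FiniteDimensional ℝ E] {r : ℕ} {T : E → E [×r]→L[ℝ] E}
    (hT : DifferentiableAt ℝ T (c t)) (hc : IsGeodesicNear h c t) (i : Fin r) :
    HasCovDerivAlongAt h c (fun s ↦ (T (c s)).toContinuousLinearMap (fun _ ↦ deriv c s) i)
      ((covDeriv h T (c t)).toContinuousLinearMap (fun _ ↦ deriv c t) i.succ) t := by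
  obtain ⟨hc1, hc2⟩ := hc.self_of_nhds
  set v := deriv c t with hv
  let K : E →L[ℝ] E := christoffel h (c t) v
  let J := fun s ↦ (T (c s)).toContinuousLinearMap (fun _ ↦ deriv c s) i
  let J' : E →L[ℝ] E := (covDeriv h T (c t)).toContinuousLinearMap (fun _ ↦ v) i.succ
    - (K ∘L J t - J t ∘L K)
  have hJ : HasDerivAt J J' t := by
    refine hasDerivAt_clm_of_apply fun y ↦ ?_
    have hTc : HasDerivAt (fun s ↦ T (c s)) (fderiv ℝ T (c t) v) t :=
      hT.hasFDerivAt.comp_hasDerivAt t hc1.hasDerivAt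
    -- Slot `i` is frozen at `y`; every other slot carries the velocity, whose derivative is `-Γ(v,
    -- v) = -K v` by the geodesic equation.
    have hg : ∀ j : Fin r, HasDerivAt (fun s ↦ Function.update (fun _ ↦ deriv c s) i y j)
        (if j = i then 0 else - K v) t := by
      intro j
      rcases eq_or_ne j i with rfl | hj
      · simpa using hasDerivAt_const t y
      · simpa [hj] using hc2
    set w := Function.update (fun _ : Fin r ↦ v) i y with hw
    have h2 : HasDerivAt (fun s ↦ J s y) (fderiv ℝ T (c t) v w +
        ∑ j, T (c t) (Function.update w j (if j = i then 0 else - K v))) t := by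
      refine (hTc.hasFDerivAt.continuousMultilinearMap_apply
        (fun j ↦ (hg j).hasFDerivAt)).hasDerivAt.congr_deriv ?_
      simp only [add_apply, ContinuousLinearMap.coe_comp, Function.comp_apply, sum_apply,
        ContinuousLinearMap.toSpanSingleton_apply, one_smul]
      rfl
    refine h2.congr_deriv ?_
    have hupd : Function.update (fun _ : Fin (r + 1) ↦ v) i.succ y = Fin.cons v w := by
      funext j
      refine Fin.cases ?_ (fun j ↦ ?_) j <;>
        simp [Function.update_apply, hw, (Fin.succ_ne_zero i).symm]
    have hcov : (covDeriv h T (c t)).toContinuousLinearMap (fun _ ↦ v) i.succ y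
        = fderiv ℝ T (c t) v w
          + (K (T (c t) w) - ∑ j, T (c t) (Function.update w j (K (w j)))) := by
      change covDeriv h T (c t) (Function.update (fun _ ↦ v) i.succ y) = _
      rw [hupd, covDeriv, ContinuousLinearMap.uncurryLeft_apply, Fin.cons_zero, Fin.tail_cons,
        ← act_apply]
      rfl
    -- The velocity slots reproduce exactly the connection terms of `∇T`. Only slot `i` leaves a
    -- correction, `J(K y)`, which is one half of the commutator in `J'`.
    have hsum : ∀ j, T (c t) (Function.update w j (if j = i then 0 else - K v))
        = - T (c t) (Function.update w j (K (w j)))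
          + if j = i then T (c t) (Function.update (fun _ ↦ v) i (K y)) else 0 := by
      intro j
      rcases eq_or_ne j i with rfl | hj
      · rw [if_pos rfl, if_pos rfl, (T (c t)).map_coord_zero j (by simp), hw]
        simp
      · rw [if_neg hj, if_neg hj, add_zero, hw, Function.update_of_ne hj]
        exact (T (c t)).map_update_neg _ _ _
    have hJt : ∀ y, J t y = T (c t) (Function.update (fun _ ↦ v) i y) := fun y ↦ rfl
    simp only [J', sub_apply, hcov, ContinuousLinearMap.coe_comp, Function.comp_apply, hsum,
      Finset.sum_add_distrib, Finset.sum_neg_distrib, Finset.sum_ite_eq', Finset.mem_univ,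
      if_true, hJt]
    rw [← hw]
    abel
  refine ⟨hJ.differentiableAt, ?_⟩
  rw [show deriv (fun s ↦ (T (c s)).toContinuousLinearMap (fun _ ↦ deriv c s) i) t = J' from
    hJ.deriv]
  simp only [J', J, K]
  abel

/-- The operator `y ↦ (∇ᵏ_{v, …, v} R)(y, v) v` in coordinates. -/
noncomputable def symmCurv (h : E → E →L[ℝ] E →L[ℝ] ℝ) (k : ℕ) (x v : E) : E →L[ℝ] E :=
  (nablaCurv h k x).toContinuousLinearMap (fun _ ↦ v) ⟨k, by omega⟩

theorem symmCurv_zero (s : ℝ) : symmCurv h 0 (c s) (deriv c s) = jacobiOp h c s := by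
  ext y
  change uncurry₃ (curv h (c s)) (Function.update _ 0 y) = _
  rw [uncurry₃_apply, jacobiOp_apply]
  rfl

/-- If the Jacobi operator along a geodesic satisfies `∇R/dt = [A, R]` with `A` parallel, then all
its covariant derivatives are iterated commutators with `A`. -/
theorem symmCurv_succ_eq_commutator [FiniteDimensional ℝ E] {I : Set ℝ} (hI : IsOpen I)
    (hΓ : ∀ t ∈ I, ContDiffAt ℝ ∞ (christoffel h) (c t)) (hc : ∀ t ∈ I, IsGeodesicNear h c t)
    {A : ℝ → E →L[ℝ] E} (hA : ∀ t ∈ I, HasCovDerivAlongAt h c A 0 t)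
    (hJ : ∀ t ∈ I, HasCovDerivAlongAt h c (jacobiOp h c)
      (A t ∘L jacobiOp h c t - jacobiOp h c t ∘L A t) t) (k : ℕ) :
    ∀ t ∈ I, symmCurv h (k + 1) (c t) (deriv c t) =
      A t ∘L symmCurv h k (c t) (deriv c t) - symmCurv h k (c t) (deriv c t) ∘L A t := by
  have hder : ∀ k, ∀ t ∈ I, HasCovDerivAlongAt h c (fun s ↦ symmCurv h k (c s) (deriv c s))
      (symmCurv h (k + 1) (c t) (deriv c t)) t := fun k t ht ↦
    hasCovDerivAlongAt_velocity ((contDiffAt_nablaCurv (hΓ t ht) k).differentiableAt (by simp))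
      (hc t ht) ⟨k, by omega⟩
  induction k with
  | zero =>
    intro t ht
    have h1 := hder 0 t ht
    simp only [symmCurv_zero] at h1 ⊢
    rw [← h1.2, ← (hJ t ht).2]
  | succ k ih =>
    intro t ht
    have h1 := hder (k + 1) t ht
    -- The induction hypothesis holds on the open set `I`, so it can be differentiated at `t`; the
    -- term with the derivative of `A` vanishes because `A` is parallel.
    have h2 := ((hA t ht).commutator (hder k t ht)).congr
      (A' := fun s ↦ symmCurv h (k + 1) (c s) (deriv c s))
      (Filter.eventually_of_mem (hI.mem_nhds ht) fun s hs ↦ ih s hs)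
    rw [← h1.2, h2.2]
    simp

end AlongCurve

/-! ### Existence of geodesics -/

section Existence

variable {h : E → E →L[ℝ] E →L[ℝ] ℝ}

/-- Short-time existence of geodesics. -/
theorem exists_isGeodesicNear [CompleteSpace E] {x : E} (hΓ : ContDiffAt ℝ ∞ (christoffel h) x)
    (v : E) : ∃ c : ℝ → E, c 0 = x ∧ deriv c 0 = v ∧
      ∃ ε > 0, ∀ t ∈ Set.Ioo (-ε) ε, IsGeodesicNear h c t := by
  -- The geodesic equation as a first-order autonomous system in position and velocity, to which
  -- Picard–Lindelöf applies.
  let F : E × E → E × E := fun p ↦ (p.2, -christoffel h p.1 p.2 p.2)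
  have hF : ContDiffAt ℝ 1 F (x, v) := by
    have hΓ1 : ContDiffAt ℝ 1 (fun p : E × E ↦ christoffel h p.1) (x, v) :=
      (hΓ.of_le (by exact_mod_cast le_top)).comp (x, v) contDiffAt_fst
    exact contDiffAt_snd.prodMk ((hΓ1.clm_apply contDiffAt_snd).clm_apply contDiffAt_snd).neg
  obtain ⟨α, hα0, ε, hε, hα⟩ :=
    hF.exists_forall_mem_closedBall_exists_eq_forall_mem_Ioo_hasDerivAt₀ 0
  simp only [zero_sub, zero_add] at hα
  have h1 : ∀ t ∈ Set.Ioo (-ε) ε, HasDerivAt (fun s ↦ (α s).1) (α t).2 t := fun t ht ↦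
    (hasFDerivAt_fst (p := α t)).comp_hasDerivAt t (hα t ht)
  have h2 : ∀ t ∈ Set.Ioo (-ε) ε, HasDerivAt (fun s ↦ (α s).2)
      (-christoffel h (α t).1 (α t).2 (α t).2) t := fun t ht ↦
    (hasFDerivAt_snd (p := α t)).comp_hasDerivAt t (hα t ht)
  refine ⟨fun s ↦ (α s).1, by simp [hα0], ?_, ε, hε, fun t ht ↦ ?_⟩
  · rw [(h1 0 (by simpa using hε)).deriv, hα0]
  · have hev : ∀ᶠ s in 𝓝 t, s ∈ Set.Ioo (-ε) ε := isOpen_Ioo.mem_nhds ht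
    filter_upwards [hev.eventually_nhds] with s hs
    refine ⟨(h1 s hs.self_of_nhds).differentiableAt, ?_⟩
    rw [(h1 s hs.self_of_nhds).deriv]
    exact (h2 s hs.self_of_nhds).congr_of_eventuallyEq (hs.mono fun r hr ↦ (h1 r hr).deriv)

end Existence

end Coord

/-! ### From charts to the manifold -/

namespace PseudoRiemannianMetric

variable {E : Type*} [NormedAddCommGroup E] [NormedSpace ℝ E]
  {M : Type*} [TopologicalSpace M] [ChartedSpace E M]

theorem toCoord_chartAt_eq_mfderiv_extChartAt (p q : M) :
    toCoord (chartAt E p) q = mfderiv 𝓘(ℝ, E) 𝓘(ℝ, E) (extChartAt 𝓘(ℝ, E) p) q := by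
  rw [extChartAt_coe]
  rfl

variable [IsManifold 𝓘(ℝ, E) ∞ M] (g : PseudoRiemannianMetric E M)

theorem isInvertible_toCoord {p q : M} (hq : q ∈ (chartAt E p).source) :
    (toCoord (chartAt E p) q).IsInvertible := by
  have : IsManifold 𝓘(ℝ, E) 1 M := .of_le (n := ∞) (by exact_mod_cast le_top)
  rw [toCoord_chartAt_eq_mfderiv_extChartAt]
  exact isInvertible_mfderiv_extChartAt (by simpa using hq)

theorem ofCoord_toCoord {p q : M} (hq : q ∈ (chartAt E p).source) (v : TangentSpace 𝓘(ℝ, E) q) :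
    ofCoord (chartAt E p) q (toCoord (chartAt E p) q v) = v :=
  (isInvertible_toCoord hq).inverse_apply_self v

theorem toCoord_ofCoord {p q : M} (hq : q ∈ (chartAt E p).source) (u : E) :
    toCoord (chartAt E p) q (ofCoord (chartAt E p) q u) = u :=
  (isInvertible_toCoord hq).self_apply_inverse u

/-- In the tangent bundle trivialization at `p`, which is the differential of the chart, this vector
field is the constant `u`. -/
theorem contMDiffOn_ofCoord (p : M) (u : E) :
    ContMDiffOn 𝓘(ℝ, E) (𝓘(ℝ, E).prod 𝓘(ℝ, E)) ∞ (fun q ↦ Bundle.TotalSpace.mk' E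
      (E := fun q : M ↦ TangentSpace 𝓘(ℝ, E) q) q (ofCoord (chartAt E p) q u))
      (chartAt E p).source := by
  have : IsManifold 𝓘(ℝ, E) 1 M := .of_le (n := ∞) (by exact_mod_cast le_top)
  have hb := TangentBundle.trivializationAt_baseSet (I := 𝓘(ℝ, E)) p
  rw [← hb, Bundle.Trivialization.contMDiffOn_section_baseSet_iff]
  refine contMDiffOn_const (c := u) |>.congr fun q hq ↦ ?_
  rw [hb] at hq
  have h1 := toCoord_ofCoord hq u
  rw [toCoord_chartAt_eq_mfderiv_extChartAt,
    ← TangentBundle.continuousLinearMapAt_trivializationAt hq,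
    Bundle.Trivialization.continuousLinearMapAt_apply,
    Bundle.Trivialization.coe_linearMapAt_of_mem _ (by rwa [hb])] at h1
  exact h1

theorem contDiffOn_coordMetric [FiniteDimensional ℝ E] (p : M) :
    ContDiffOn ℝ ∞ (g.coordMetric (chartAt E p)) (chartAt E p).target := by
  refine contDiffOn_clm_apply.2 fun u ↦ contDiffOn_clm_apply.2 fun v ↦ ?_
  rw [← contMDiffOn_iff_contDiffOn]
  have h1 : ContMDiffOn 𝓘(ℝ, E) 𝓘(ℝ, ℝ) ∞
      (fun q : M ↦ g.inner q (ofCoord (chartAt E p) q u) (ofCoord (chartAt E p) q v))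
      (chartAt E p).source := by
    intro q hq
    have h2 : ContMDiffWithinAt 𝓘(ℝ, E) (𝓘(ℝ, E).prod 𝓘(ℝ, ℝ)) ∞
        (fun q : M ↦ Bundle.TotalSpace.mk' ℝ (E := Bundle.Trivial M ℝ) q
          (g.inner q (ofCoord (chartAt E p) q u) (ofCoord (chartAt E p) q v)))
        (chartAt E p).source q := by
      apply ContMDiffWithinAt.clm_bundle_apply₂ (F₁ := E) (F₂ := E)
      · exact g.contMDiff.contMDiffAt.contMDiffWithinAt
      · exact contMDiffOn_ofCoord p u q hq
      · exact contMDiffOn_ofCoord p v q hq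
    simp only [Bundle.contMDiffWithinAt_totalSpace] at h2
    exact h2.2
  exact h1.comp (contMDiffOn_chart_symm (x := p)) fun x hx ↦ (chartAt E p).map_target hx

theorem contDiffAt_coordMetric [FiniteDimensional ℝ E] (p : M) {x : E}
    (hx : x ∈ (chartAt E p).target) : ContDiffAt ℝ ∞ (g.coordMetric (chartAt E p)) x :=
  (g.contDiffOn_coordMetric p).contDiffAt ((chartAt E p).open_target.mem_nhds hx)

theorem coordMetric_symm (e : OpenPartialHomeomorph M E) (x v w : E) :
    g.coordMetric e x v w = g.coordMetric e x w v :=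
  g.symm _ _ _

theorem coordMetric_chart_apply (e : OpenPartialHomeomorph M E) {q : M} (hq : q ∈ e.source)
    (v w : E) : g.coordMetric e (e q) v w = g.inner q (ofCoord e q v) (ofCoord e q w) := by
  rw [coordMetric_apply, e.left_inv hq]

/-- Nondegeneracy gives injectivity, and `E` has the same finite dimension as its dual. -/
theorem isInvertible_coordMetric [FiniteDimensional ℝ E] (p : M) {x : E}
    (hx : x ∈ (chartAt E p).target) : (g.coordMetric (chartAt E p) x).IsInvertible := by
  have hq := (chartAt E p).map_target hx
  let f : E →ₗ[ℝ] Module.Dual ℝ E :=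
    LinearMap.toContinuousLinearMap.symm.toLinearMap ∘ₗ (g.coordMetric (chartAt E p) x).toLinearMap
  have hinj : Function.Injective (g.coordMetric (chartAt E p) x).toLinearMap := by
    rw [← LinearMap.ker_eq_bot, LinearMap.ker_eq_bot']
    intro u hu
    have h0 : ofCoord (chartAt E p) ((chartAt E p).symm x) u = 0 := by
      refine g.nondegenerate _ _ fun w ↦ ?_
      have := congrArg (fun L : E →L[ℝ] ℝ ↦ L (toCoord (chartAt E p) _ w)) hu
      simpa [coordMetric_apply, ofCoord_toCoord hq] using this
    rw [← toCoord_ofCoord hq u, h0, map_zero]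
  have hrank : Module.finrank ℝ E = Module.finrank ℝ (E →L[ℝ] ℝ) := by
    rw [← LinearMap.toContinuousLinearMap.finrank_eq (R := ℝ) (M := E →ₗ[ℝ] ℝ)]
    exact (Subspace.dual_finrank_eq (K := ℝ) (V := E)).symm
  let L := LinearEquiv.ofInjectiveOfFinrankEq _ hinj hrank
  exact ⟨L.toContinuousLinearEquiv, by ext; rfl⟩

theorem symmCurv_apply (k : ℕ) (p : M) (X Y : TangentSpace 𝓘(ℝ, E) p) :
    g.symmCurv k p X Y = ofCoord (chartAt E p) p
      (Coord.symmCurv (g.coordMetric (chartAt E p)) k (chartAt E p p)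
        (toCoord (chartAt E p) p X) (toCoord (chartAt E p) p Y)) := by
  change ofCoord (chartAt E p) p (Coord.nablaCurv (g.coordMetric (chartAt E p)) k (chartAt E p p)
    (fun i ↦ toCoord (chartAt E p) p (Function.update (fun _ ↦ X) _ Y i))) = _
  have h1 : (fun i ↦ toCoord (chartAt E p) p
      (Function.update (fun _ : Fin (3 + k) ↦ X) ⟨k, by omega⟩ Y i)) =
      Function.update (fun _ ↦ toCoord (chartAt E p) p X) ⟨k, by omega⟩
        (toCoord (chartAt E p) p Y) :=
    funext fun i ↦ Function.apply_update (fun _ v ↦ toCoord (chartAt E p) p v) _ _ _ _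
  rw [h1]
  rfl

/-- In a `ℭ₀`-space, the symmetrized covariant derivatives of the curvature at `X` are the iterated
commutators of the Jacobi operator with a skew-symmetric endomorphism. -/
theorem IsCZeroSpace.exists_skew_symmCurv_succ [FiniteDimensional ℝ E] (hg : g.IsCZeroSpace)
    (p : M) (X : TangentSpace 𝓘(ℝ, E) p) :
    ∃ C : TangentSpace 𝓘(ℝ, E) p →L[ℝ] TangentSpace 𝓘(ℝ, E) p,
      (∀ u v, g.inner p (C u) v = - g.inner p u (C v)) ∧
      ∀ k, g.symmCurv (k + 1) p X = C ∘L g.symmCurv k p X - g.symmCurv k p X ∘L C := by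
  have : CompleteSpace E := FiniteDimensional.complete ℝ E
  set e := chartAt E p with he
  have hp : p ∈ e.source := mem_chart_source E p
  have hΓ : ∀ x ∈ e.target, ContDiffAt ℝ ∞ (Coord.christoffel (g.coordMetric e)) x := fun x hx ↦
    Coord.contDiffAt_christoffel (g.contDiffAt_coordMetric p hx) (g.isInvertible_coordMetric p hx)
  obtain ⟨c, hc0, hc'0', ε, hε, hc⟩ :=
    Coord.exists_isGeodesicNear (hΓ _ (e.map_source hp)) (toCoord e p X)
  have hcont : ContinuousAt c 0 :=
    (hc 0 (by simpa using hε)).self_of_nhds.1.continuousAt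
  have hev : ∀ᶠ t in 𝓝 (0 : ℝ), c t ∈ e.target :=
    hcont.eventually_mem (hc0 ▸ e.open_target.mem_nhds (e.map_source hp))
  obtain ⟨δ, hδ, hδt⟩ := Metric.eventually_nhds_iff.1 hev
  -- The interval is shrunk until the coordinate geodesic stays inside the chart, so that it can be
  -- lifted to `M`.
  let I := Set.Ioo (-min ε δ) (min ε δ)
  have hI : IsOpen I := isOpen_Ioo
  have h0I : (0 : ℝ) ∈ I := by simp [I, hε, hδ]
  have hIt : ∀ t ∈ I, c t ∈ e.target := fun t ht ↦ hδt (by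
    rw [Real.dist_eq, sub_zero, abs_lt]
    exact ⟨by linarith [ht.1, min_le_right ε δ], ht.2.trans_le (min_le_right _ _)⟩)
  have hIc : ∀ t ∈ I, Coord.IsGeodesicNear (g.coordMetric e) c t := fun t ht ↦
    hc t ⟨by linarith [ht.1, min_le_left ε δ], ht.2.trans_le (min_le_left _ _)⟩
  let γ : ℝ → M := fun t ↦ e.symm (c t)
  have hγs : ∀ t ∈ I, γ t ∈ e.source := fun t ht ↦ e.map_target (hIt t ht)
  have hγ : ∀ t ∈ I, e (γ t) = c t := fun t ht ↦ e.right_inv (hIt t ht)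
  -- The `ℭ₀` condition is phrased for `e ∘ γ`, which agrees with `c` only on `I`; germs at points
  -- of `I` are enough for derivatives.
  let c' : ℝ → E := fun s ↦ e (γ s)
  have hcc' : ∀ t ∈ I, c' =ᶠ[𝓝 t] c := fun t ht ↦
    Filter.eventually_of_mem (hI.mem_nhds ht) hγ
  have hc'geo : ∀ t ∈ I, Coord.IsGeodesicNear (g.coordMetric e) c' t := fun t ht ↦
    (hIc t ht).congr (hcc' t ht)
  obtain ⟨C, hCskew, hC⟩ := hg I γ hI Set.ordConnected_Ioo fun t ht ↦
    ⟨e, chart_mem_atlas E p, Filter.eventually_of_mem (hI.mem_nhds ht) hγs, hc'geo t ht⟩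
  let A := coordEndo e γ C
  have hsucc := fun k ↦ Coord.symmCurv_succ_eq_commutator hI
    (fun t ht ↦ hΓ _ (e.map_source (hγs t ht))) hc'geo
    (fun t ht ↦ (hC e (chart_mem_atlas E p) t ht (hγs t ht)).1)
    (fun t ht ↦ (hC e (chart_mem_atlas E p) t ht (hγs t ht)).2) k 0 h0I
  have hc'0 : c' 0 = e p := (hγ 0 h0I).trans hc0
  have hγ0 : γ 0 = p := by simp only [γ, hc0, e.left_inv hp]
  have hdc'0 : deriv c' 0 = toCoord e p X := (hcc' 0 h0I).deriv_eq.trans hc'0'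
  change ∀ k, Coord.symmCurv (g.coordMetric e) (k + 1) (c' 0) (deriv c' 0) =
    A 0 ∘L Coord.symmCurv (g.coordMetric e) k (c' 0) (deriv c' 0) -
      Coord.symmCurv (g.coordMetric e) k (c' 0) (deriv c' 0) ∘L A 0 at hsucc
  rw [hc'0, hdc'0] at hsucc
  -- `C 0` acts on the tangent space at `γ 0`, which equals `p` only propositionally. Its coordinate
  -- form `A 0` acts on the fixed space `E`, so skewness can be carried to `p` by rewriting.
  have hA : ∀ u v, g.coordMetric e (e p) (A 0 u) v = - g.coordMetric e (e p) u (A 0 v) := by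
    intro u v
    have h1 : ∀ u v, g.coordMetric e (e (γ 0)) (A 0 u) v =
        - g.coordMetric e (e (γ 0)) u (A 0 v) := by
      intro u v
      rw [g.coordMetric_chart_apply e (hγs 0 h0I), g.coordMetric_chart_apply e (hγs 0 h0I)]
      simp only [A, coordEndo, ContinuousLinearMap.coe_comp, Function.comp_apply]
      rw [ofCoord_toCoord (hγs 0 h0I), ofCoord_toCoord (hγs 0 h0I)]
      exact hCskew 0 h0I _ _
    rw [hγ0] at h1
    exact h1 u v
  refine ⟨ofCoord e p ∘L A 0 ∘L toCoord e p, fun u v ↦ ?_, fun k ↦ ?_⟩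
  · have h1 := hA (toCoord e p u) (toCoord e p v)
    rw [g.coordMetric_chart_apply e hp, g.coordMetric_chart_apply e hp, ofCoord_toCoord hp,
      ofCoord_toCoord hp] at h1
    exact h1
  · ext Y
    simp only [sub_apply, ContinuousLinearMap.coe_comp, Function.comp_apply, symmCurv_apply]
    rw [← he, toCoord_ofCoord hp, toCoord_ofCoord hp, hsucc k]
    simp

theorem ricci_self (p : M) (X : TangentSpace 𝓘(ℝ, E) p) :
    g.ricci p X X = LinearMap.trace ℝ _ (g.symmCurv 0 p X).toLinearMap := by
  have h1 : (g.nablaCurv 0 p).toContinuousLinearMap ![0, X, X] 0 = g.symmCurv 0 p X := by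
    ext Y
    change g.nablaCurv 0 p (Function.update ![0, X, X] 0 Y) =
      g.nablaCurv 0 p (Function.update (fun _ ↦ X) 0 Y)
    congr 1
    funext i
    fin_cases i <;> rfl
  rw [ricci, h1]

/-- The trace is invariant under conjugation by the chart differential; bilinearity and symmetry of
the Ricci tensor are then read off in coordinates. -/
theorem ricci_eq_trace_curv (p : M) (X Y : TangentSpace 𝓘(ℝ, E) p) :
    g.ricci p X Y = LinearMap.trace ℝ E
      (((Coord.curv (g.coordMetric (chartAt E p)) (chartAt E p p)).flip
        (toCoord (chartAt E p) p X)).flip (toCoord (chartAt E p) p Y)).toLinearMap := by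
  have hp : p ∈ (chartAt E p).source := mem_chart_source E p
  let f : TangentSpace 𝓘(ℝ, E) p ≃ₗ[ℝ] E :=
    { toLinearMap := (toCoord (chartAt E p) p).toLinearMap
      invFun := ofCoord (chartAt E p) p
      left_inv := ofCoord_toCoord hp
      right_inv := toCoord_ofCoord hp }
  rw [ricci, ← LinearMap.trace_conj' _ f]
  congr 1
  ext u
  change toCoord (chartAt E p) p (ofCoord (chartAt E p) p
    (Coord.uncurry₃ (Coord.curv (g.coordMetric (chartAt E p)) (chartAt E p p)) fun i ↦
      toCoord (chartAt E p) p (Function.update ![0, X, Y] (0 : Fin 3)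
        (ofCoord (chartAt E p) p u) i))) = _
  rw [toCoord_ofCoord hp, Coord.uncurry₃_apply]
  change Coord.curv _ _ (toCoord (chartAt E p) p (ofCoord (chartAt E p) p u))
    (toCoord (chartAt E p) p X) (toCoord (chartAt E p) p Y) = _
  rw [toCoord_ofCoord hp]
  rfl

theorem ricci_symm [FiniteDimensional ℝ E] (p : M) (X Y : TangentSpace 𝓘(ℝ, E) p) :
    g.ricci p X Y = g.ricci p Y X := by
  rw [ricci_eq_trace_curv, ricci_eq_trace_curv]
  have hx := (chartAt E p).map_source (mem_chart_source E p)
  refine Coord.trace_curv_symm (g.contDiffAt_coordMetric p hx) ?_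
    (.of_forall fun y ↦ g.coordMetric_symm _ y) _ _
  filter_upwards [(chartAt E p).open_target.mem_nhds hx] with y hy
  exact g.isInvertible_coordMetric p hy

end PseudoRiemannianMetric

/-! ### Polynomial functions restricted to lines -/

section Poly

variable {V : Type*} [AddCommGroup V] [Module ℝ V]

theorem coeff_specialize (P : Polynomial (PolyFun V)) (X : V) (i : ℕ) :
    (specialize P X).coeff i = (P.coeff i : V → ℝ) X := by
  rw [specialize, Polynomial.coeff_map]
  rfl

/-- The restriction of a polynomial function to a line is a polynomial. -/
theorem exists_polynomial_of_mem_polyFun {f : V → ℝ} (hf : f ∈ PolyFun V) (X Y : V) :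
    ∃ q : Polynomial ℝ, ∀ t : ℝ, f (X + t • Y) = q.eval t := by
  induction hf using Algebra.adjoin_induction with
  | mem f hf =>
    obtain ⟨φ, rfl⟩ := hf
    exact ⟨.C (φ X) + .C (φ Y) * .X, fun t ↦ by simp [mul_comm (φ Y)]⟩
  | algebraMap r => exact ⟨.C r, fun t ↦ by simp⟩
  | add f g _ _ hf hg =>
    obtain ⟨p, hp⟩ := hf
    obtain ⟨q, hq⟩ := hg
    exact ⟨p + q, fun t ↦ by simp [hp, hq]⟩
  | mul f g _ _ hf hg =>
    obtain ⟨p, hp⟩ := hf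
    obtain ⟨q, hq⟩ := hg
    exact ⟨p * q, fun t ↦ by simp [hp, hq]⟩

/-- A polynomial function that vanishes wherever a given nonzero quadratic form does not vanish is
zero. -/
theorem eq_zero_of_mul_bilin_eq_zero {f : V → ℝ} (hf : f ∈ PolyFun V) (B : V →ₗ[ℝ] V →ₗ[ℝ] ℝ)
    {X : V} (hX : B X X ≠ 0) (h : ∀ Y, f Y * B Y Y = 0) : f = 0 := by
  funext Y
  -- On the line from `X` at `t = 0` to `Y` at `t = 1`, the quadratic form is a polynomial `b` with
  -- `b(0) = B X X ≠ 0`. As `ℝ[t]` is a domain, `q * b = 0` forces `q = 0`, and `t = 1` gives `f Y =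
  -- 0`.
  obtain ⟨q, hq⟩ := exists_polynomial_of_mem_polyFun hf X (Y - X)
  let b : Polynomial ℝ := .C (B X X) + .X * .C (B X (Y - X) + B (Y - X) X)
    + .X ^ 2 * .C (B (Y - X) (Y - X))
  have hb : ∀ t : ℝ, B (X + t • (Y - X)) (X + t • (Y - X)) = b.eval t := by
    intro t
    simp only [b, Polynomial.eval_add, Polynomial.eval_mul, Polynomial.eval_C, Polynomial.eval_X,
      Polynomial.eval_pow, map_add, map_smul, LinearMap.add_apply, LinearMap.smul_apply,
      smul_eq_mul]
    ring
  have hqb : q * b = 0 := Polynomial.funext fun t ↦ by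
    rw [Polynomial.eval_mul, ← hq, ← hb, h, Polynomial.eval_zero]
  have hb0 : b ≠ 0 := by
    intro h0
    have := hb 0
    rw [h0] at this
    simp at this
    exact hX this
  have := hq 1
  rw [(mul_eq_zero.1 hqb).resolve_right hb0] at this
  simpa using this

end Poly

/-! ### The Ricci form, the specialized relation and the theorem -/

namespace PseudoRiemannianMetric

variable {E : Type*} [NormedAddCommGroup E] [NormedSpace ℝ E]
  {M : Type*} [TopologicalSpace M] [ChartedSpace E M] [IsManifold 𝓘(ℝ, E) ∞ M]
  (g : PseudoRiemannianMetric E M)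

instance finiteDimensional_tangentSpace [FiniteDimensional ℝ E] (p : M) :
    FiniteDimensional ℝ (TangentSpace 𝓘(ℝ, E) p) :=
  inferInstanceAs (FiniteDimensional ℝ E)

/-- The metric at a point as a bilinear form. -/
noncomputable def toBilin (p : M) :
    TangentSpace 𝓘(ℝ, E) p →ₗ[ℝ] TangentSpace 𝓘(ℝ, E) p →ₗ[ℝ] ℝ :=
  LinearMap.mk₂ ℝ (fun v w ↦ g.inner p v w) (by simp) (by simp) (by simp) (by simp)

/-- The Ricci tensor at a point as a bilinear form. -/
noncomputable def ricciBilin (p : M) :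
    TangentSpace 𝓘(ℝ, E) p →ₗ[ℝ] TangentSpace 𝓘(ℝ, E) p →ₗ[ℝ] ℝ :=
  LinearMap.mk₂ ℝ (g.ricci p)
    (fun X X' Y ↦ by
      simp only [ricci_eq_trace_curv, ← map_add]
      congr 1; ext; simp)
    (fun r X Y ↦ by
      simp only [ricci_eq_trace_curv, ← map_smul]
      congr 1; ext; simp)
    (fun X Y Y' ↦ by
      simp only [ricci_eq_trace_curv, ← map_add]
      congr 1; ext; simp)
    (fun r X Y ↦ by
      simp only [ricci_eq_trace_curv, ← map_smul]
      congr 1; ext; simp)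

/-- Polarization: a symmetric bilinear form is determined by its quadratic form. -/
theorem exists_ricci_self_ne_zero [FiniteDimensional ℝ E] {p : M} (h : g.ricci p ≠ 0) :
    ∃ X, g.ricci p X X ≠ 0 := by
  by_contra! h0
  refine h (funext fun X ↦ funext fun Y ↦ ?_)
  have h1 : g.ricciBilin p (X + Y) (X + Y) = 0 := h0 (X + Y)
  have h2 : g.ricciBilin p X X = 0 := h0 X
  have h3 : g.ricciBilin p Y Y = 0 := h0 Y
  have h4 : g.ricciBilin p Y X = g.ricciBilin p X Y := g.ricci_symm p Y X
  simp only [map_add, LinearMap.add_apply, h2, h3, h4] at h1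
  change g.ricciBilin p X Y = 0
  linarith

theorem evalCurv_eq_sum_specialize {p : M}
    (P : Polynomial (PolyFun (TangentSpace 𝓘(ℝ, E) p))) (hP : P.Monic)
    (X : TangentSpace 𝓘(ℝ, E) p) :
    (g.evalCurv p P X).toLinearMap =
      (specialize P X).sum fun i a ↦ a • (g.symmCurv i p X).toLinearMap := by
  have hdeg : (specialize P X).natDegree = P.natDegree := hP.natDegree_map _
  rw [evalCurv, Polynomial.sum_over_range _ (by simp), Polynomial.sum_over_range _ (by simp), hdeg]
  ext Y
  simp [coeff_specialize]

end PseudoRiemannianMetric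

theorem mainTheorem5 {E : Type*} [NormedAddCommGroup E] [NormedSpace ℝ E] [FiniteDimensional ℝ E]
    {M : Type*} [TopologicalSpace M] [ChartedSpace E M] [IsManifold 𝓘(ℝ, E) ∞ M]
    (g : PseudoRiemannianMetric E M) (hg : g.IsCZeroSpace) (p : M)
    (P : Polynomial (PolyFun (TangentSpace 𝓘(ℝ, E) p))) (hP : g.IsMinimalPolynomial p P) :
    (g.IsPosDef → ∀ X ∈ g.regularSet p P.natDegree, ∀ z : ℂ,
      ((specialize P X).map (algebraMap ℝ ℂ)).IsRoot z →
        z.re = 0 ∧ ((specialize P X).map (algebraMap ℝ ℂ)).rootMultiplicity z = 1) ∧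
    (g.ricci p ≠ 0 → P.coeff 0 = 0) := by
  obtain ⟨⟨hmonic, -, heval⟩, -⟩ := hP
  have hsum : ∀ X, ((specialize P X).sum fun i a ↦ a • (g.symmCurv i p X).toLinearMap) = 0 := by
    intro X
    rw [← g.evalCurv_eq_sum_specialize P hmonic, heval, ContinuousLinearMap.toLinearMap_zero]
  constructor
  · intro hpos X hX z hz
    obtain ⟨C, hCskew, hC⟩ := hg.exists_skew_symmCurv_succ g p X
    -- Monicity prevents the degree from dropping, so the independence defining `U(p)` is exactly
    -- minimality for the specialization.
    have hdeg : (specialize P X).natDegree = P.natDegree := hmonic.natDegree_map _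
    refine root_of_skew_iterated_commutator (g.toBilin p) (g.symm p) (hpos p) C.toLinearMap hCskew
      (fun k ↦ (g.symmCurv k p X).toLinearMap) (fun k ↦ ?_) (specialize P X)
      (hmonic.map _).ne_zero (hsum X) ?_ hz
    · rw [hC]
      rfl
    · rw [hdeg]
      exact LinearIndependent.map' hX (ContinuousLinearMap.coeLM ℝ)
        (LinearMap.ker_eq_bot.2 ContinuousLinearMap.coe_injective)
  · intro hric
    obtain ⟨X₀, hX₀⟩ := g.exists_ricci_self_ne_zero hric
    refine Subtype.ext (eq_zero_of_mul_bilin_eq_zero (P.coeff 0).2 (g.ricciBilin p) hX₀ fun X ↦ ?_)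
    obtain ⟨C, -, hC⟩ := hg.exists_skew_symmCurv_succ g p X
    have htr : ∀ k, LinearMap.trace ℝ _ (g.symmCurv (k + 1) p X).toLinearMap = 0 := by
      intro k
      rw [hC]
      change LinearMap.trace ℝ _ (C.toLinearMap * (g.symmCurv k p X).toLinearMap
        - (g.symmCurv k p X).toLinearMap * C.toLinearMap) = 0
      rw [map_sub, LinearMap.trace_mul_comm, sub_self]
    -- In the trace of the relation all terms with `i ≥ 1` are traces of commutators; the remaining
    -- term `i = 0` is `a_k(X) Ric(X, X)`, with `a_k = P.coeff 0`.
    have h1 := congrArg (LinearMap.trace ℝ _) (hsum X)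
    rw [Polynomial.sum_over_range _ (by simp), map_sum, map_zero, Finset.sum_range_succ'] at h1
    simp only [map_smul, htr, smul_zero, Finset.sum_const_zero, zero_add, ← g.ricci_self,
      coeff_specialize] at h1
    exact h1
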